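/- Let $d,N\ge 1$ be integers and $\sigma^2,\epsilon\ge 0$. Let $A$ be a random $N\times d$ real matrix whose entries are independent of one another (pairwise independence suffices), each with mean $0$ and variance $1/d$. Let $\mathcal E$ be the single-layer ReLU environment with weights $A$: given $A$ and an input $X\sim\mathcal N(0,I_d)$ independent of $A$, the output $Y\in\mathbb R^N$ has law $P^*=\mathcal E(\cdot\mid X)=\mathcal N(\mathrm{ReLU}(AX),\sigma^2 I_N)$, where $\mathrm{ReLU}(t)=\max(t,0)$ acts coordinatewise; $\mathcal E$ is identified with $A$. An environment proxy is a random variable $\tilde{\mathcal E}$, with values in a standard Borel space and defined jointly with $(\mathcal E,X,Y)$ on some probability space, such that $\tilde{\mathcal E}\perp (X,Y)\mid\mathcal E$; put $\tilde P=\mathbb P(Y\in\cdot\mid\tilde{\mathcal E},X)$. Let $$\mathbb H_\epsilon(\mathcal E)=\inf\left\{\mathbb I(\mathcal E;\tilde{\mathcal E}) : \tilde{\mathcal E}\text{ is an environment proxy with } \mathbb E\left[D_{\mathrm{KL}}(P^*\,\|\,\tilde P)\right]\le\epsilon\right\}$$ be the rate-distortion function of $\mathcal E$, in nats. Then $$\mathbb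 H_\epsilon(\mathcal E)\le\frac{dN}{2}\,\max\left\{0,\ \ln\left(\frac{N}{2\sigma^2\epsilon}\right)\right\},$$ where the right-hand side is $+\infty$ if $\sigma^2\epsilon=0$. In particular, $\mathbb H_\epsilon(\mathcal E)\le\frac{dN}{2}\ln\left(\frac{N}{2\sigma^2\epsilon}\right)$ whenever $2\sigma^2\epsilon\le N$. -/

import Mathlib

open MeasureTheory ProbabilityTheory InformationTheory
open scoped NNReal ENNReal

/-! ### Rate-distortion function of an environment

An environment assigns to each input `x : 𝒳` a conditional distribution of the output in `𝒴`.
A random environment is identified by a random parameter in `Θ` with law `prior`; the Markov kernel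
`env : Kernel (Θ × 𝒳) 𝒴` sends `(θ, x)` to the output distribution that the environment `θ`
assigns to the input `x`. -/

/-- Mutual information `I(U; V)` (in nats) of two random variables on `(Ω, P)`: the
Kullback-Leibler divergence of the joint law from the product of the marginal laws. -/
noncomputable def mutualInformation {Ω α β : Type*} [MeasurableSpace Ω] [MeasurableSpace α]
    [MeasurableSpace β] (U : Ω → α) (V : Ω → β) (P : Measure Ω) : ℝ≥0∞ :=
  klDiv (P.map fun ω => (U ω, V ω)) ((P.map U).prod (P.map V))

/-- The joint law of the environment `θ ~ prior`, the input `X ~ inputLaw` (independent of `θ`),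
and the output `Y`, whose conditional law given `(θ, X)` is `env (θ, X)`. -/
noncomputable def environmentLaw {Θ 𝒳 𝒴 : Type*} [MeasurableSpace Θ] [MeasurableSpace 𝒳]
    [MeasurableSpace 𝒴] (prior : Measure Θ) (inputLaw : Measure 𝒳) (env : Kernel (Θ × 𝒳) 𝒴)
    [IsMarkovKernel env] : Measure ((Θ × 𝒳) × 𝒴) :=
  (prior.prod inputLaw) ⊗ₘ env

/-- The random variable `Z` on `(Ω, P)` is a proxy of the environment `θ`:
`Z` is conditionally independent of the pair `(X, Y)` given `θ`. -/
def IsEnvironmentProxy {Ω Θ 𝒳 𝒴 S : Type*} [MeasurableSpace Ω] [StandardBorelSpace Ω]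
    [MeasurableSpace Θ] [MeasurableSpace 𝒳] [MeasurableSpace 𝒴] [MeasurableSpace S]
    (P : Measure Ω) [IsFiniteMeasure P]
    (θ : Ω → Θ) (X : Ω → 𝒳) (Y : Ω → 𝒴) (Z : Ω → S) : Prop :=
  Measurable Z ∧ ∃ hθ : Measurable θ,
    CondIndepFun (MeasurableSpace.comap θ inferInstance) hθ.comap_le
      Z (fun ω => (X ω, Y ω)) P

/-- The distortion `𝔼[D_KL(P* ‖ P̃)]` of the proxy `Z`, where `P* = env (θ, X)` is the output
distribution prescribed by the environment and `P̃ = ℙ(Y ∈ · | Z, X)` is the prediction based on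
the proxy. -/
noncomputable def proxyDistortion {Ω Θ 𝒳 𝒴 S : Type*} [MeasurableSpace Ω]
    [MeasurableSpace Θ] [MeasurableSpace 𝒳] [MeasurableSpace 𝒴] [StandardBorelSpace 𝒴]
    [Nonempty 𝒴] [MeasurableSpace S]
    (env : Kernel (Θ × 𝒳) 𝒴) (P : Measure Ω) [IsFiniteMeasure P]
    (θ : Ω → Θ) (X : Ω → 𝒳) (Y : Ω → 𝒴) (Z : Ω → S) : ℝ≥0∞ :=
  ∫⁻ ω, klDiv (env (θ ω, X ω)) (condDistrib Y (fun ω' => (Z ω', X ω')) P (Z ω, X ω)) ∂P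

/-- The rate-distortion function `ℍ_ε`: the infimum of `I(θ; Z)` over all environment proxies `Z`
with distortion at most `ε`. The proxies range over all random variables `Z`, with values in any
standard Borel space `S`, that are defined jointly with `(θ, X, Y)` on some probability space. -/
noncomputable def rateDistortion {Θ 𝒳 𝒴 : Type*} [MeasurableSpace Θ] [MeasurableSpace 𝒳]
    [MeasurableSpace 𝒴] [StandardBorelSpace 𝒴] [Nonempty 𝒴]
    (prior : Measure Θ) (inputLaw : Measure 𝒳) (env : Kernel (Θ × 𝒳) 𝒴) [IsMarkovKernel env]
    (ε : ℝ≥0) : ℝ≥0∞ :=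
  sInf {r : ℝ≥0∞ |
    ∃ (Ω : Type) (_ : MeasurableSpace Ω) (_ : StandardBorelSpace Ω)
      (P : Measure Ω) (_ : IsProbabilityMeasure P)
      (S : Type) (_ : MeasurableSpace S) (_ : StandardBorelSpace S)
      (θ : Ω → Θ) (X : Ω → 𝒳) (Y : Ω → 𝒴) (Z : Ω → S),
      Measurable θ ∧ Measurable X ∧ Measurable Y ∧
      P.map (fun ω => ((θ ω, X ω), Y ω)) = environmentLaw prior inputLaw env ∧
      IsEnvironmentProxy P θ X Y Z ∧
      proxyDistortion env P θ X Y Z ≤ (ε : ℝ≥0∞) ∧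
      r = mutualInformation θ Z P}

/-! ### The single-layer ReLU environment -/

/-- The single-layer ReLU network `x ↦ ReLU(A x)`, with `ReLU(t) = max t 0` applied
coordinatewise. -/
def reluLayer {N d : ℕ} (A : Fin N → Fin d → ℝ) (x : Fin d → ℝ) (i : Fin N) : ℝ :=
  max (∑ j, A i j * x j) 0

theorem measurable_gaussianProduct_relu (N d : ℕ) (σsq : ℝ≥0) :
    Measurable fun p : (Fin N → Fin d → ℝ) × (Fin d → ℝ) =>
      Measure.pi fun i => gaussianReal (reluLayer p.1 p.2 i) σsq := by
  have h : (fun p : (Fin N → Fin d → ℝ) × (Fin d → ℝ) =>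
      Measure.pi fun i => gaussianReal (reluLayer p.1 p.2 i) σsq) =
      fun p => (Measure.pi fun _ : Fin N => gaussianReal 0 σsq).map
        (fun w i => reluLayer p.1 p.2 i + w i) := by
    funext p
    have key : (fun i => gaussianReal (reluLayer p.1 p.2 i) σsq) =
        fun i => (gaussianReal 0 σsq).map (reluLayer p.1 p.2 i + ·) := by
      funext i
      rw [gaussianReal_map_const_add, zero_add]
    have hs : ∀ i : Fin N,
        SigmaFinite ((gaussianReal 0 σsq).map (reluLayer p.1 p.2 i + ·)) := by
      intro i
      rw [gaussianReal_map_const_add]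
      infer_instance
    rw [key]
    exact (Measure.pi_map_pi (fun i => by fun_prop)).symm
  rw [h]
  refine Measure.measurable_of_measurable_coe _ fun s hs => ?_
  have hg : Measurable fun q : ((Fin N → Fin d → ℝ) × (Fin d → ℝ)) × (Fin N → ℝ) =>
      fun i => reluLayer q.1.1 q.1.2 i + q.2 i := by
    unfold reluLayer
    fun_prop
  have e : ∀ p : (Fin N → Fin d → ℝ) × (Fin d → ℝ),
      ((Measure.pi fun _ : Fin N => gaussianReal 0 σsq).map
        (fun w i => reluLayer p.1 p.2 i + w i)) s =
      (Measure.pi fun _ : Fin N => gaussianReal 0 σsq) (Prod.mk p ⁻¹'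
        ((fun q : ((Fin N → Fin d → ℝ) × (Fin d → ℝ)) × (Fin N → ℝ) =>
          fun i => reluLayer q.1.1 q.1.2 i + q.2 i) ⁻¹' s)) := by
    intro p
    exact Measure.map_apply (hg.comp measurable_prodMk_left) hs
  simp_rw [e]
  exact measurable_measure_prodMk_left (hg hs)

/-- The single-layer ReLU environment with weight matrix `A` and noise variance `σsq`:
the output given the input `x` is distributed `N(ReLU(A x), σsq I_N)`. -/
noncomputable def reluEnvironment (N d : ℕ) (σsq : ℝ≥0) :
    Kernel ((Fin N → Fin d → ℝ) × (Fin d → ℝ)) (Fin N → ℝ) where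
  toFun p := Measure.pi fun i => gaussianReal (reluLayer p.1 p.2 i) σsq
  measurable' := measurable_gaussianProduct_relu N d σsq

instance (N d : ℕ) (σsq : ℝ≥0) : IsMarkovKernel (reluEnvironment N d σsq) where
  isProbabilityMeasure p := by
    change IsProbabilityMeasure (Measure.pi fun i => gaussianReal (reluLayer p.1 p.2 i) σsq)
    infer_instance

/-- The standard Gaussian distribution `N(0, I_d)` of the input. -/
noncomputable def standardGaussianInput (d : ℕ) : Measure (Fin d → ℝ) :=
  Measure.pi fun _ => gaussianReal 0 1

/-- The independent prior on an `N × d` random weight matrix: the entries are independent of one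
another, each with mean `0` and variance `1 / d`. Only pairwise independence is required. -/
structure IndependentPrior {Ω : Type*} [MeasurableSpace Ω] {N d : ℕ}
    (A : Ω → Fin N → Fin d → ℝ) (P : Measure Ω) : Prop where
  measurable : Measurable A
  indep : ∀ i j l m, (i, j) ≠ (l, m) → IndepFun (fun ω => A ω i j) (fun ω => A ω l m) P
  memLp : ∀ i j, MemLp (fun ω => A ω i j) 2 P
  mean_eq : ∀ i j, ∫ ω, A ω i j ∂P = 0
  variance_eq : ∀ i j, variance (fun ω => A ω i j) P = 1 / (d : ℝ)

/-! The bound comes from one explicit test channel: the proxy is `Z = α A + W` with independent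
centered Gaussian noise of variance `v` in each entry, and the prediction plugs `Z` into the ReLU
environment as if it were the true matrix.

Distortion. The true conditional law of `Y` given `(Z, X)` is at least as good a predictor as the
plug-in one (`klDiv_condDistrib_le`). Gaussians with common covariance `σ² I` diverge by the squared
distance of their means over `2σ²`, ReLU is 1-Lipschitz, and `X` is isotropic, so the distortion is
at most `𝔼‖A - Z‖² / (2σ²)` (`gaussianChannel_distortion_le`).

Rate. Replacing the law of `Z` by any reference law can only increase the divergence that defines
mutual information (`mutualInformation_le_klDiv_prod`). Against centered Gaussian entries of
variance `s = v + α²/d`, the divergence is quadratic in the entries of `A`, so their second moment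
`1/d` determines its mean, `(dN/2) ln (s/v)` (`gaussianChannel_klDiv_eq`).

With `δ = 2σ²ε/N < 1`, the choice `α = 1 - δ`, `v = δ(1 - δ)/d` makes the distortion bound exactly
`ε` and `s/v = 1/δ`. For `δ ≥ 1` a constant proxy suffices. Both variational inequalities are the
chain rule with a nonnegative term dropped. -/

/-! ### Kullback-Leibler divergence: conditional form, equivalences, products -/

section KullbackLeibler

variable {α β γ : Type*} {mα : MeasurableSpace α} {mβ : MeasurableSpace β} {mγ : MeasurableSpace γ}

theorem klDiv_kernel_eq_lintegral [MeasurableSpace.CountableOrCountablyGenerated α β]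
    (κ η : Kernel α β) [IsFiniteKernel κ] [IsFiniteKernel η] {a : α} (h : κ a ≪ η a) :
    klDiv (κ a) (η a) = ∫⁻ b, ENNReal.ofReal (klFun (κ.rnDeriv η a b).toReal) ∂η a := by
  rw [klDiv_eq_lintegral_klFun_of_ac h]
  refine lintegral_congr_ae ?_
  filter_upwards [Kernel.rnDeriv_eq_rnDeriv_measure (κ := κ) (η := η) (a := a)] with b hb
  rw [hb]

/-- The kernel derivative is jointly measurable, which settles the points of absolute continuity;
these form a measurable set, and the divergence is infinite elsewhere. -/
theorem measurable_klDiv_kernel [MeasurableSpace.CountableOrCountablyGenerated α β]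
    (κ η : Kernel α β) [IsFiniteKernel κ] [IsFiniteKernel η] :
    Measurable fun a => klDiv (κ a) (η a) := by
  classical
  have h : (fun a => klDiv (κ a) (η a)) = fun a => if κ a ≪ η a then
      ∫⁻ b, ENNReal.ofReal (klFun (κ.rnDeriv η a b).toReal) ∂η a else ∞ := by
    funext a
    split_ifs with ha
    · exact klDiv_kernel_eq_lintegral κ η ha
    · exact klDiv_of_not_ac ha
  rw [h]
  refine Measurable.ite (Kernel.measurableSet_absolutelyContinuous κ η) ?_ measurable_const
  refine Measurable.lintegral_kernel_prod_right (f := fun a b =>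
    ENNReal.ofReal (klFun (κ.rnDeriv η a b).toReal)) ?_
  exact (measurable_klFun.comp (Kernel.measurable_rnDeriv κ η).ennreal_toReal).ennreal_ofReal

/-- The divergence of two composition-products with the same first marginal is the conditional
divergence. -/
theorem klDiv_compProd_eq_lintegral [MeasurableSpace.CountableOrCountablyGenerated α β]
    (μ : Measure α) [IsFiniteMeasure μ] (κ η : Kernel α β) [IsFiniteKernel κ] [IsFiniteKernel η] :
    klDiv (μ ⊗ₘ κ) (μ ⊗ₘ η) = ∫⁻ a, klDiv (κ a) (η a) ∂μ := by
  by_cases hac : ∀ᵐ a ∂μ, κ a ≪ η a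
  · have hκ : (fun a => κ a) =ᵐ[μ] fun a => η.withDensity (κ.rnDeriv η) a := by
      filter_upwards [hac] with a ha using (Kernel.withDensity_rnDeriv_eq ha).symm
    have hm : Measurable fun p : α × β => κ.rnDeriv η p.1 p.2 := Kernel.measurable_rnDeriv κ η
    have hd : μ ⊗ₘ κ = (μ ⊗ₘ η).withDensity fun p => κ.rnDeriv η p.1 p.2 := by
      rw [Measure.compProd_congr hκ, Measure.compProd_withDensity hm]
    have hab : μ ⊗ₘ κ ≪ μ ⊗ₘ η := by
      rw [hd]
      exact withDensity_absolutelyContinuous _ _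
    have hr : (μ ⊗ₘ κ).rnDeriv (μ ⊗ₘ η) =ᵐ[μ ⊗ₘ η] fun p => κ.rnDeriv η p.1 p.2 := by
      rw [hd]
      exact Measure.rnDeriv_withDensity _ hm
    have hmk : Measurable fun p : α × β =>
        ENNReal.ofReal (klFun (κ.rnDeriv η p.1 p.2).toReal) :=
      (measurable_klFun.comp hm.ennreal_toReal).ennreal_ofReal
    rw [klDiv_eq_lintegral_klFun_of_ac hab]
    calc ∫⁻ p, ENNReal.ofReal (klFun ((μ ⊗ₘ κ).rnDeriv (μ ⊗ₘ η) p).toReal) ∂(μ ⊗ₘ η)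
        = ∫⁻ p, ENNReal.ofReal (klFun (κ.rnDeriv η p.1 p.2).toReal) ∂(μ ⊗ₘ η) := by
          refine lintegral_congr_ae ?_
          filter_upwards [hr] with p hp
          rw [hp]
      _ = ∫⁻ a, ∫⁻ b, ENNReal.ofReal (klFun (κ.rnDeriv η a b).toReal) ∂η a ∂μ :=
          Measure.lintegral_compProd hmk
      _ = ∫⁻ a, klDiv (κ a) (η a) ∂μ := by
          refine lintegral_congr_ae ?_
          filter_upwards [hac] with a ha
          rw [klDiv_kernel_eq_lintegral κ η ha]
  -- Here both sides are infinite: a finite integral would make the fibre divergences finite almost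
  -- everywhere, forcing absolute continuity there.
  · have h1 : ¬ μ ⊗ₘ κ ≪ μ ⊗ₘ η := fun h => hac h.kernel_of_compProd
    rw [klDiv_of_not_ac h1]
    symm
    by_contra htop
    refine hac ?_
    filter_upwards [ae_lt_top (measurable_klDiv_kernel κ η) htop] with a ha
    exact (klDiv_ne_top_iff.mp ha.ne).1

/-- Data processing, applied to the map and to its inverse. -/
theorem klDiv_map_measurableEquiv (e : α ≃ᵐ β) (μ ν : Measure α) [IsFiniteMeasure μ]
    [IsFiniteMeasure ν] : klDiv (μ.map e) (ν.map e) = klDiv μ ν := by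
  refine le_antisymm (klDiv_map_le μ ν e.measurable) ?_
  have h := klDiv_map_le (μ.map e) (ν.map e) e.symm.measurable
  rwa [Measure.map_map e.symm.measurable e.measurable, Measure.map_map e.symm.measurable
    e.measurable, e.symm_comp_self, Measure.map_id, Measure.map_id] at h

theorem klDiv_prod [MeasurableSpace.CountableOrCountablyGenerated α β]
    (μ₁ ν₁ : Measure α) (μ₂ ν₂ : Measure β) [IsProbabilityMeasure μ₁] [IsProbabilityMeasure ν₁]
    [IsProbabilityMeasure μ₂] [IsProbabilityMeasure ν₂] :
    klDiv (μ₁.prod μ₂) (ν₁.prod ν₂) = klDiv μ₁ ν₁ + klDiv μ₂ ν₂ := by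
  rw [← Measure.compProd_const, ← Measure.compProd_const, klDiv_compProd_eq_add,
    klDiv_compProd_eq_lintegral]
  simp

theorem klDiv_pi_fin {E : Type*} [MeasurableSpace E] [StandardBorelSpace E]
    (n : ℕ) (μ ν : Fin n → Measure E) [∀ i, IsProbabilityMeasure (μ i)]
    [∀ i, IsProbabilityMeasure (ν i)] :
    klDiv (Measure.pi μ) (Measure.pi ν) = ∑ i, klDiv (μ i) (ν i) := by
  induction n with
  | zero =>
    rw [Measure.pi_of_empty μ, Measure.pi_of_empty ν, klDiv_self]
    simp
  | succ n ih =>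
    have h := klDiv_map_measurableEquiv (MeasurableEquiv.piFinSuccAbove (fun _ => E) 0)
      (Measure.pi μ) (Measure.pi ν)
    rw [(measurePreserving_piFinSuccAbove μ 0).map_eq,
      (measurePreserving_piFinSuccAbove ν 0).map_eq, klDiv_prod, ih] at h
    rw [← h, Fin.sum_univ_succ]
    simp

/-- Two variables drawn independently given the first coordinate can be drawn in either order, by
Tonelli. -/
theorem compProd_prodMkRight_swap (ν : Measure α) [SFinite ν] (κ : Kernel α β) [IsSFiniteKernel κ]
    (η : Kernel α γ) [IsSFiniteKernel η] :
    ((ν ⊗ₘ κ) ⊗ₘ η.prodMkRight β).map (fun p => ((p.1.1, p.2), p.1.2)) =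
      (ν ⊗ₘ η) ⊗ₘ κ.prodMkRight γ := by
  refine Measure.ext_of_lintegral _ fun f hf => ?_
  have hg : Measurable fun p : (α × β) × γ => ((p.1.1, p.2), p.1.2) := by fun_prop
  rw [lintegral_map hf hg, Measure.lintegral_compProd (by fun_prop),
    Measure.lintegral_compProd (by fun_prop), Measure.lintegral_compProd (by fun_prop),
    Measure.lintegral_compProd (by fun_prop)]
  refine lintegral_congr fun a => ?_
  simp only [Kernel.prodMkRight_apply]
  rw [lintegral_lintegral_swap]
  have h2 : Measurable fun q : β × γ => ((a, q.2), q.1) := by fun_prop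
  exact (hf.comp h2).aemeasurable

end KullbackLeibler

section MutualInformation

variable {Ω 𝒯 𝒰 𝒴 : Type*} [MeasurableSpace Ω] [MeasurableSpace 𝒯] [MeasurableSpace 𝒰]
  [StandardBorelSpace 𝒰] [Nonempty 𝒰] [MeasurableSpace 𝒴] [StandardBorelSpace 𝒴] [Nonempty 𝒴]

/-- Among all predictions of `Y` that are based on `T`, the conditional law of `Y` given `T` has
the smallest divergence from the joint law of `(T, U, Y)`. -/
theorem klDiv_condDistrib_le (P : Measure Ω) [IsProbabilityMeasure P] {T : Ω → 𝒯} {U : Ω → 𝒰}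
    {Y : Ω → 𝒴} (hT : Measurable T) (hU : Measurable U) (hY : Measurable Y) (Q : Kernel 𝒯 𝒴)
    [IsMarkovKernel Q] :
    klDiv (P.map fun ω => ((T ω, U ω), Y ω))
        ((P.map fun ω => (T ω, U ω)) ⊗ₘ (condDistrib Y T P).prodMkRight 𝒰) ≤
      klDiv (P.map fun ω => ((T ω, U ω), Y ω))
        ((P.map fun ω => (T ω, U ω)) ⊗ₘ Q.prodMkRight 𝒰) := by
  let e : (𝒯 × 𝒴) × 𝒰 ≃ᵐ (𝒯 × 𝒰) × 𝒴 :=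
    { toFun := fun p => ((p.1.1, p.2), p.1.2)
      invFun := fun p => ((p.1.1, p.2), p.1.2)
      left_inv := fun _ => rfl
      right_inv := fun _ => rfl
      measurable_toFun := by
        change Measurable fun p : (𝒯 × 𝒴) × 𝒰 => ((p.1.1, p.2), p.1.2); fun_prop
      measurable_invFun := by
        change Measurable fun p : (𝒯 × 𝒰) × 𝒴 => ((p.1.1, p.2), p.1.2); fun_prop }
  have : IsProbabilityMeasure (P.map T) := Measure.isProbabilityMeasure_map hT.aemeasurable
  have : IsProbabilityMeasure (P.map fun ω => (T ω, Y ω)) :=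
    Measure.isProbabilityMeasure_map (by fun_prop)
  have hTU : (P.map fun ω => (T ω, U ω)) = P.map T ⊗ₘ condDistrib U T P :=
    (compProd_map_condDistrib hU.aemeasurable).symm
  have hTY : (P.map fun ω => (T ω, Y ω)) = P.map T ⊗ₘ condDistrib Y T P :=
    (compProd_map_condDistrib hY.aemeasurable).symm
  have hTYU : (P.map fun ω => ((T ω, U ω), Y ω)) =
      ((P.map fun ω => (T ω, Y ω)) ⊗ₘ condDistrib U (fun ω => (T ω, Y ω)) P).map e := by
    rw [compProd_map_condDistrib hU.aemeasurable, Measure.map_map e.measurable (by fun_prop)]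
    rfl
  have hswap : ∀ (η : Kernel 𝒯 𝒴) [IsMarkovKernel η],
      (P.map fun ω => (T ω, U ω)) ⊗ₘ η.prodMkRight 𝒰 =
        ((P.map T ⊗ₘ η) ⊗ₘ (condDistrib U T P).prodMkRight 𝒴).map e := by
    intro η _
    rw [hTU]
    exact (compProd_prodMkRight_swap _ _ _).symm
  -- Reordered as `((T, Y), U)`, the chain rule splits the divergence for `Q` into that of the law
  -- of `(T, Y)` from `P.map T ⊗ₘ Q` plus a term free of `Q`. That second term is exactly the
  -- left-hand side.
  rw [hswap, hswap, hTYU, klDiv_map_measurableEquiv, klDiv_map_measurableEquiv,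
    klDiv_compProd_eq_add _ (P.map T ⊗ₘ Q), ← hTY]
  exact le_add_self

/-- Upper bound on the mutual information by the divergence from an arbitrary output law. -/
theorem mutualInformation_le_klDiv_prod (P : Measure Ω) [IsProbabilityMeasure P] {U : Ω → 𝒰}
    {V : Ω → 𝒯} (hU : Measurable U) (hV : Measurable V) (Q : Measure 𝒯) [IsProbabilityMeasure Q] :
    mutualInformation U V P ≤ klDiv (P.map fun ω => (U ω, V ω)) ((P.map U).prod Q) := by
  have : IsProbabilityMeasure (P.map U) := Measure.isProbabilityMeasure_map hU.aemeasurable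
  have : IsProbabilityMeasure (P.map V) := Measure.isProbabilityMeasure_map hV.aemeasurable
  have hVU : (P.map fun ω => (U ω, V ω)) =
      (P.map V ⊗ₘ condDistrib U V P).map MeasurableEquiv.prodComm := by
    rw [compProd_map_condDistrib hU.aemeasurable,
      Measure.map_map MeasurableEquiv.prodComm.measurable (by fun_prop)]
    rfl
  have hprod : ∀ (R : Measure 𝒯) [IsProbabilityMeasure R],
      (P.map U).prod R = (R ⊗ₘ Kernel.const 𝒯 (P.map U)).map MeasurableEquiv.prodComm := by
    intro R _
    rw [Measure.compProd_const]
    exact Measure.prod_swap.symm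
  -- With `V` drawn first, the chain rule shows that the excess over the mutual information is the
  -- divergence of the law of `V` from `Q`.
  rw [mutualInformation, hprod, hprod Q, hVU, klDiv_map_measurableEquiv, klDiv_map_measurableEquiv,
    klDiv_compProd_eq_add _ Q]
  exact le_add_self

end MutualInformation

/-! ### Gaussian computations -/

section Gaussian

theorem memLp_sub_const_gaussianReal (m : ℝ) (v : ℝ≥0) (c : ℝ) :
    MemLp (fun x => x - c) 2 (gaussianReal m v) :=
  (memLp_id_gaussianReal 2).sub (memLp_const c)

theorem integral_sub_sq_gaussianReal (m : ℝ) (v : ℝ≥0) (c : ℝ) :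
    ∫ x, (x - c) ^ 2 ∂gaussianReal m v = v + (m - c) ^ 2 := by
  have h := variance_eq_sub (memLp_sub_const_gaussianReal m v c)
  have h1 : Var[fun x => x - c; gaussianReal m v] = v := by
    rw [variance_sub_const (X := fun x : ℝ => x) measurable_id.aestronglyMeasurable]
    exact variance_fun_id_gaussianReal
  have h2 : ∫ x, (x - c) ∂gaussianReal m v = m - c := by
    rw [integral_sub _ (integrable_const c), integral_id_gaussianReal]
    · simp
    · exact (memLp_id_gaussianReal 1).integrable le_rfl
  rw [h1, h2] at h
  simp only [Pi.pow_apply] at h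
  linarith

theorem lintegral_sub_sq_gaussianReal (m : ℝ) (v : ℝ≥0) (c : ℝ) :
    ∫⁻ x, ENNReal.ofReal ((x - c) ^ 2) ∂gaussianReal m v = ENNReal.ofReal (v + (m - c) ^ 2) := by
  rw [← ofReal_integral_eq_lintegral_ofReal (memLp_sub_const_gaussianReal m v c).integrable_sq
    (ae_of_all _ fun _ => sq_nonneg _), integral_sub_sq_gaussianReal]

/-- The coordinates are independent, centered and of unit variance, so the variance of the sum is
the sum of the variances. -/
theorem lintegral_linear_sq_standardGaussianInput {d : ℕ} (c : Fin d → ℝ) :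
    ∫⁻ x, ENNReal.ofReal ((∑ j, c j * x j) ^ 2) ∂standardGaussianInput d =
      ENNReal.ofReal (∑ j, c j ^ 2) := by
  have hX : ∀ j, MemLp (fun t : ℝ => c j * t) 2 (gaussianReal 0 1) := fun j =>
    (memLp_id_gaussianReal 2).const_mul (c j)
  have hev : ∀ j, MemLp (fun x : Fin d → ℝ => c j * x j) 2 (standardGaussianInput d) := fun j =>
    (hX j).comp_measurePreserving (measurePreserving_eval (fun _ : Fin d => gaussianReal 0 1) j)
  have hsum : MemLp (fun x : Fin d → ℝ => ∑ j, c j * x j) 2 (standardGaussianInput d) :=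
    memLp_finsetSum _ fun j _ => hev j
  have hprob : IsProbabilityMeasure (standardGaussianInput d) := by
    unfold standardGaussianInput
    infer_instance
  have hmean : ∫ x, ∑ j, c j * x j ∂standardGaussianInput d = 0 := by
    rw [integral_finsetSum _ fun j _ => (hev j).integrable one_le_two]
    refine Finset.sum_eq_zero fun j _ => ?_
    rw [integral_const_mul]
    have h := integral_map (μ := standardGaussianInput d) (φ := fun x : Fin d → ℝ => x j) (f := id)
      (measurable_pi_apply j).aemeasurable measurable_id.aestronglyMeasurable
    have hm : (standardGaussianInput d).map (fun x : Fin d → ℝ => x j) = gaussianReal 0 1 :=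
      (measurePreserving_eval (fun _ : Fin d => gaussianReal 0 1) j).map_eq
    rw [hm] at h
    simp only [id_eq, integral_id_gaussianReal] at h
    rw [← h, mul_zero]
  have hvar : Var[fun x : Fin d → ℝ => ∑ j, c j * x j; standardGaussianInput d] =
      ∑ j, c j ^ 2 := by
    have h := variance_sum_pi (μ := fun _ : Fin d => gaussianReal 0 1) (X := fun j t => c j * t) hX
    have h' : (fun x : Fin d → ℝ => ∑ j, c j * x j) =
        ∑ j, fun x : Fin d → ℝ => c j * x j := by
      funext x
      simp
    rw [standardGaussianInput, h', h]
    refine Finset.sum_congr rfl fun j _ => ?_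
    rw [variance_const_mul, variance_fun_id_gaussianReal]
    simp
  have h := variance_eq_sub hsum
  rw [hvar, hmean] at h
  rw [← ofReal_integral_eq_lintegral_ofReal hsum.integrable_sq (ae_of_all _ fun _ => sq_nonneg _), h]
  simp

theorem log_gaussianPDFReal (m : ℝ) {v : ℝ≥0} (hv : v ≠ 0) (x : ℝ) :
    Real.log (gaussianPDFReal m v x) =
      -(Real.log (2 * Real.pi) + Real.log v) / 2 - (x - m) ^ 2 / (2 * v) := by
  have hv' : (0 : ℝ) < v := by positivity
  have h2 : (0 : ℝ) < 2 * Real.pi := by positivity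
  rw [gaussianPDFReal_def]
  simp only
  rw [Real.log_mul (by positivity) (Real.exp_pos _).ne', Real.log_inv, Real.log_sqrt (by positivity),
    Real.log_exp, Real.log_mul h2.ne' hv'.ne']
  ring

theorem gaussianReal_eq_withDensity_gaussianReal (m m' : ℝ) {v v' : ℝ≥0} (hv : v ≠ 0)
    (hv' : v' ≠ 0) :
    gaussianReal m v =
      (gaussianReal m' v').withDensity fun x => gaussianPDF m v x / gaussianPDF m' v' x := by
  rw [gaussianReal_of_var_ne_zero m hv, gaussianReal_of_var_ne_zero m' hv',
    ← withDensity_mul (g := fun x => gaussianPDF m v x / gaussianPDF m' v' x) _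
      (measurable_gaussianPDF m' v')
      ((measurable_gaussianPDF m v).div (measurable_gaussianPDF m' v'))]
  congr 1
  funext x
  exact (ENNReal.mul_div_cancel (gaussianPDF_pos m' hv' x).ne' gaussianPDF_ne_top).symm

/-- The log-likelihood ratio is a quadratic polynomial, so its mean needs only the second moments of
the first Gaussian about `m` and `m'`. -/
theorem klDiv_gaussianReal (m m' : ℝ) {v v' : ℝ≥0} (hv : v ≠ 0) (hv' : v' ≠ 0) :
    klDiv (gaussianReal m v) (gaussianReal m' v') =
      ENNReal.ofReal ((Real.log v' - Real.log v) / 2 + (v + (m - m') ^ 2) / (2 * v') - 1 / 2) := by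
  have hd := gaussianReal_eq_withDensity_gaussianReal m m' hv hv'
  have hac : gaussianReal m v ≪ gaussianReal m' v' := by
    rw [hd]
    exact withDensity_absolutelyContinuous _ _
  have hr : (gaussianReal m v).rnDeriv (gaussianReal m' v') =ᵐ[gaussianReal m v]
      fun x => gaussianPDF m v x / gaussianPDF m' v' x := by
    refine hac.ae_le ?_
    have h := Measure.rnDeriv_withDensity (gaussianReal m' v')
      ((measurable_gaussianPDF m v).div (measurable_gaussianPDF m' v'))
    exact hd ▸ h
  have hllr : llr (gaussianReal m v) (gaussianReal m' v') =ᵐ[gaussianReal m v] fun x =>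
      (Real.log v' - Real.log v) / 2 - (1 / (2 * v)) * (x - m) ^ 2
        + (1 / (2 * v')) * (x - m') ^ 2 := by
    filter_upwards [hr] with x hx
    rw [llr_def]
    simp only
    rw [hx, ENNReal.toReal_div, toReal_gaussianPDF, toReal_gaussianPDF,
      Real.log_div (gaussianPDFReal_pos m v x hv).ne' (gaussianPDFReal_pos m' v' x hv').ne',
      log_gaussianPDFReal m hv, log_gaussianPDFReal m' hv']
    ring
  have i1 : Integrable (fun x => (1 / (2 * (v : ℝ))) * (x - m) ^ 2) (gaussianReal m v) :=
    (memLp_sub_const_gaussianReal m v m).integrable_sq.const_mul _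
  have i2 : Integrable (fun x => (1 / (2 * (v' : ℝ))) * (x - m') ^ 2) (gaussianReal m v) :=
    (memLp_sub_const_gaussianReal m v m').integrable_sq.const_mul _
  have i0 : Integrable (fun _ : ℝ => (Real.log v' - Real.log v) / 2) (gaussianReal m v) :=
    integrable_const _
  have hint := integral_add (i0.sub i1) i2
  simp only [Pi.sub_apply] at hint
  rw [klDiv_of_ac_of_integrable hac (((i0.sub i1).add i2).congr hllr.symm),
    integral_congr_ae hllr, hint, integral_sub i0 i1, integral_const_mul,
    integral_const_mul, integral_sub_sq_gaussianReal, integral_sub_sq_gaussianReal]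
  have hv0 : (v : ℝ) ≠ 0 := by exact_mod_cast hv
  have hv0' : (v' : ℝ) ≠ 0 := by exact_mod_cast hv'
  congr 1
  simp
  field_simp
  ring

end Gaussian

/-! ### Proxies generated by a channel -/

section Channel

variable {Θ 𝒳 𝒴 S : Type*} [MeasurableSpace Θ] [MeasurableSpace 𝒳] [MeasurableSpace 𝒴]
  [MeasurableSpace S]

/-- The joint law of `(θ, X, Y)` and a proxy that is generated from `θ` by the channel `κ`. -/
noncomputable def channelLaw (prior : Measure Θ) (inputLaw : Measure 𝒳) (env : Kernel (Θ × 𝒳) 𝒴)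
    [IsMarkovKernel env] (κ : Kernel Θ S) : Measure (((Θ × 𝒳) × 𝒴) × S) :=
  environmentLaw prior inputLaw env ⊗ₘ κ.comap (fun p : (Θ × 𝒳) × 𝒴 => p.1.1) (by fun_prop)

variable (prior : Measure Θ) [IsProbabilityMeasure prior] (inputLaw : Measure 𝒳)
  [IsProbabilityMeasure inputLaw] (env : Kernel (Θ × 𝒳) 𝒴) [IsMarkovKernel env] (κ : Kernel Θ S)
  [IsMarkovKernel κ]

instance : IsProbabilityMeasure (environmentLaw prior inputLaw env) := by
  unfold environmentLaw
  infer_instance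

instance : IsProbabilityMeasure (channelLaw prior inputLaw env κ) := by
  unfold channelLaw
  infer_instance

theorem channelLaw_map_fst :
    (channelLaw prior inputLaw env κ).map (fun p => p.1) = environmentLaw prior inputLaw env :=
  Measure.fst_compProd _ _

/-- The iterated integral follows the order of sampling; the marginals and conditional laws of the
channel below are identified by testing functions against it. -/
theorem lintegral_channelLaw {f : ((Θ × 𝒳) × 𝒴) × S → ℝ≥0∞} (hf : Measurable f) :
    ∫⁻ p, f p ∂channelLaw prior inputLaw env κ =
      ∫⁻ a, ∫⁻ x, ∫⁻ y, ∫⁻ z, f (((a, x), y), z) ∂κ a ∂env (a, x) ∂inputLaw ∂prior := by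
  rw [channelLaw, Measure.lintegral_compProd hf, environmentLaw]
  have h := hf.lintegral_kernel_prod_right'
    (κ := κ.comap (fun p : (Θ × 𝒳) × 𝒴 => p.1.1) (by fun_prop))
  rw [Measure.lintegral_compProd h, lintegral_prod _ h.lintegral_kernel_prod_right'.aemeasurable]
  rfl

theorem channelLaw_map_parameter_proxy :
    (channelLaw prior inputLaw env κ).map (fun p => (p.1.1.1, p.2)) = prior ⊗ₘ κ := by
  refine Measure.ext_of_lintegral _ fun f hf => ?_
  rw [lintegral_map hf (by fun_prop), lintegral_channelLaw _ _ _ _ (by fun_prop),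
    Measure.lintegral_compProd hf]
  simp

theorem channelLaw_map_parameter :
    (channelLaw prior inputLaw env κ).map (fun p => p.1.1.1) = prior := by
  have h := congrArg Measure.fst (channelLaw_map_parameter_proxy prior inputLaw env κ)
  rwa [Measure.fst_compProd, Measure.fst_map_prodMk (by fun_prop)] at h

/-- The law of `((proxy, input), parameter)`. -/
theorem lintegral_map_proxy_input_parameter {f : (S × 𝒳) × Θ → ℝ≥0∞} (hf : Measurable f) :
    ∫⁻ p, f p ∂(channelLaw prior inputLaw env κ).map (fun p => ((p.2, p.1.1.2), p.1.1.1)) =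
      ∫⁻ a, ∫⁻ z, ∫⁻ x, f ((z, x), a) ∂inputLaw ∂κ a ∂prior := by
  rw [lintegral_map hf (by fun_prop), lintegral_channelLaw _ _ _ _ (by fun_prop)]
  refine lintegral_congr fun a => ?_
  simp only [lintegral_const, measure_univ, mul_one]
  rw [lintegral_lintegral_swap]
  have h : Measurable fun q : 𝒳 × S => ((q.2, q.1), a) := by fun_prop
  exact (hf.comp h).aemeasurable

/-- Once the parameter and the input are known, the proxy carries no further information on the
output. -/
theorem channelLaw_map_eq_compProd_environment :
    (channelLaw prior inputLaw env κ).map (fun p => (((p.2, p.1.1.2), p.1.1.1), p.1.2)) =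
      ((channelLaw prior inputLaw env κ).map fun p => ((p.2, p.1.1.2), p.1.1.1)) ⊗ₘ
        env.comap (fun q : (S × 𝒳) × Θ => (q.2, q.1.2)) (by fun_prop) := by
  have hm : IsProbabilityMeasure
      ((channelLaw prior inputLaw env κ).map fun p => ((p.2, p.1.1.2), p.1.1.1)) :=
    Measure.isProbabilityMeasure_map (by fun_prop)
  refine Measure.ext_of_lintegral _ fun f hf => ?_
  have h := hf.lintegral_kernel_prod_right'
    (κ := env.comap (fun q : (S × 𝒳) × Θ => (q.2, q.1.2)) (by fun_prop))
  rw [lintegral_map hf (by fun_prop), lintegral_channelLaw _ _ _ _ (by fun_prop),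
    Measure.lintegral_compProd hf, lintegral_map h (by fun_prop)]
  have hg : Measurable fun p : ((Θ × 𝒳) × 𝒴) × S => ((p.2, p.1.1.2), p.1.1.1) := by fun_prop
  refine Eq.trans ?_ (lintegral_channelLaw prior inputLaw env κ (h.comp hg)).symm
  refine lintegral_congr fun a => lintegral_congr fun x => ?_
  simp only [lintegral_const, measure_univ, mul_one, Kernel.comap_apply, Function.comp_apply]
  rw [lintegral_lintegral_swap]
  have h : Measurable fun q : 𝒴 × S => (((q.2, x), a), q.1) := by fun_prop
  exact (hf.comp h).aemeasurable

variable [StandardBorelSpace Θ] [StandardBorelSpace 𝒴] [Nonempty 𝒴]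

/-- This is `klDiv_condDistrib_le` with `T` the pair (proxy, input) and `U` the parameter: since the
output given all three follows `env`, both divergences become averaged fibre divergences. -/
theorem proxyDistortion_channelLaw_le [Nonempty Θ] (Q : Kernel (S × 𝒳) 𝒴) [IsMarkovKernel Q] :
    proxyDistortion env (channelLaw prior inputLaw env κ) (fun p => p.1.1.1) (fun p => p.1.1.2)
        (fun p => p.1.2) (fun p => p.2) ≤
      ∫⁻ a, ∫⁻ z, ∫⁻ x, klDiv (env (a, x)) (Q (z, x)) ∂inputLaw ∂κ a ∂prior := by
  set P := channelLaw prior inputLaw env κ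
  have hT : Measurable fun p : ((Θ × 𝒳) × 𝒴) × S => (p.2, p.1.1.2) := by fun_prop
  have hU : Measurable fun p : ((Θ × 𝒳) × 𝒴) × S => p.1.1.1 := by fun_prop
  have hY : Measurable fun p : ((Θ × 𝒳) × 𝒴) × S => p.1.2 := by fun_prop
  have hm : IsProbabilityMeasure (P.map fun p => ((p.2, p.1.1.2), p.1.1.1)) :=
    Measure.isProbabilityMeasure_map (by fun_prop)
  have h := klDiv_condDistrib_le P hT hU hY Q
  rw [channelLaw_map_eq_compProd_environment prior inputLaw env κ, klDiv_compProd_eq_lintegral,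
    klDiv_compProd_eq_lintegral, lintegral_map (measurable_klDiv_kernel _ _) (by fun_prop),
    lintegral_map_proxy_input_parameter _ _ _ _ (measurable_klDiv_kernel _ _)] at h
  exact h

variable [StandardBorelSpace 𝒳] [StandardBorelSpace S] [Nonempty 𝒳] [Nonempty S]

/-- Given `(θ, X, Y)` the proxy has law `κ θ`, the same as given `θ` alone. -/
theorem isEnvironmentProxy_channelLaw :
    IsEnvironmentProxy (channelLaw prior inputLaw env κ) (fun p => p.1.1.1) (fun p => p.1.1.2)
      (fun p => p.1.2) (fun p => p.2) := by
  have hθ : Measurable fun p : ((Θ × 𝒳) × 𝒴) × S => p.1.1.1 := by fun_prop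
  have hXY : Measurable fun p : ((Θ × 𝒳) × 𝒴) × S => (p.1.1.2, p.1.2) := by fun_prop
  have hXYθ : Measurable fun p : ((Θ × 𝒳) × 𝒴) × S => (p.1.1.1, (p.1.1.2, p.1.2)) := by fun_prop
  refine ⟨measurable_snd, hθ, CondIndepFun.symm ?_⟩
  refine (condIndepFun_iff_condDistrib_prod_ae_eq_prodMkRight measurable_snd hXY hθ).mpr ?_
  have h1 : condDistrib (fun p : ((Θ × 𝒳) × 𝒴) × S => p.2) (fun p => p.1.1.1)
      (channelLaw prior inputLaw env κ)
      =ᵐ[(channelLaw prior inputLaw env κ).map fun p => p.1.1.1] κ := by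
    refine condDistrib_ae_eq_of_measure_eq_compProd _ measurable_snd.aemeasurable ?_
    rw [channelLaw_map_parameter]
    exact channelLaw_map_parameter_proxy prior inputLaw env κ
  have h2 : condDistrib (fun p : ((Θ × 𝒳) × 𝒴) × S => p.2)
      (fun p => (p.1.1.1, (p.1.1.2, p.1.2))) (channelLaw prior inputLaw env κ)
      =ᵐ[(channelLaw prior inputLaw env κ).map fun p => (p.1.1.1, (p.1.1.2, p.1.2))]
        κ.prodMkRight (𝒳 × 𝒴) := by
    refine condDistrib_ae_eq_of_measure_eq_compProd _ measurable_snd.aemeasurable ?_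
    have hm : IsProbabilityMeasure
        ((channelLaw prior inputLaw env κ).map fun p => (p.1.1.1, (p.1.1.2, p.1.2))) :=
      Measure.isProbabilityMeasure_map (by fun_prop)
    refine Measure.ext_of_lintegral _ fun f hf => ?_
    have h := hf.lintegral_kernel_prod_right' (κ := κ.prodMkRight (𝒳 × 𝒴))
    rw [lintegral_map hf (by fun_prop), lintegral_channelLaw _ _ _ _ (by fun_prop),
      Measure.lintegral_compProd hf, lintegral_map h (by fun_prop)]
    refine Eq.trans ?_ (lintegral_channelLaw prior inputLaw env κ (h.comp hXYθ)).symm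
    simp
  have h3 : (κ.prodMkRight (𝒳 × 𝒴) : (Θ × 𝒳 × 𝒴) → Measure S)
      =ᵐ[(channelLaw prior inputLaw env κ).map fun p => (p.1.1.1, (p.1.1.2, p.1.2))]
      (condDistrib (fun p : ((Θ × 𝒳) × 𝒴) × S => p.2) (fun p => p.1.1.1)
        (channelLaw prior inputLaw env κ)).prodMkRight (𝒳 × 𝒴) := by
    have hq : Measure.QuasiMeasurePreserving Prod.fst
        ((channelLaw prior inputLaw env κ).map fun p => (p.1.1.1, (p.1.1.2, p.1.2)))
        ((channelLaw prior inputLaw env κ).map fun p => p.1.1.1) := by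
      refine ⟨measurable_fst, ?_⟩
      rw [Measure.map_map measurable_fst (by fun_prop)]
      exact Measure.AbsolutelyContinuous.rfl
    filter_upwards [hq.ae h1] with q hq
    rw [Kernel.prodMkRight_apply, Kernel.prodMkRight_apply, hq]
  exact h2.trans h3

end Channel

section RateDistortion

variable {Θ 𝒳 𝒴 S : Type} [MeasurableSpace Θ] [MeasurableSpace 𝒳] [MeasurableSpace 𝒴]
  [MeasurableSpace S] [StandardBorelSpace Θ] [StandardBorelSpace 𝒳] [StandardBorelSpace 𝒴]
  [StandardBorelSpace S] [Nonempty Θ] [Nonempty 𝒳] [Nonempty 𝒴] [Nonempty S]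

/-- Test-channel bound for the rate-distortion function: `κ` generates the proxy, `Q` is an
arbitrary prediction of the output based on the proxy, and `R` an arbitrary law on proxies. -/
theorem rateDistortion_le_of_channel (prior : Measure Θ) [IsProbabilityMeasure prior]
    (inputLaw : Measure 𝒳) [IsProbabilityMeasure inputLaw] (env : Kernel (Θ × 𝒳) 𝒴)
    [IsMarkovKernel env] (κ : Kernel Θ S) [IsMarkovKernel κ] (Q : Kernel (S × 𝒳) 𝒴)
    [IsMarkovKernel Q] (R : Measure S) [IsProbabilityMeasure R] {ε : ℝ≥0}
    (h : ∫⁻ a, ∫⁻ z, ∫⁻ x, klDiv (env (a, x)) (Q (z, x)) ∂inputLaw ∂κ a ∂prior ≤ ε) :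
    rateDistortion prior inputLaw env ε ≤ ∫⁻ a, klDiv (κ a) R ∂prior := by
  have hI := mutualInformation_le_klDiv_prod (channelLaw prior inputLaw env κ)
    (U := fun p => p.1.1.1) (V := fun p => p.2) (by fun_prop) (by fun_prop) R
  rw [channelLaw_map_parameter_proxy, channelLaw_map_parameter, ← Measure.compProd_const,
    klDiv_compProd_eq_lintegral] at hI
  refine le_trans (sInf_le ?_) hI
  exact ⟨((Θ × 𝒳) × 𝒴) × S, inferInstance, inferInstance, channelLaw prior inputLaw env κ,
    inferInstance, S, inferInstance, inferInstance, fun p => p.1.1.1, fun p => p.1.1.2,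
    fun p => p.1.2, fun p => p.2, by fun_prop, by fun_prop, by fun_prop,
    channelLaw_map_fst prior inputLaw env κ, isEnvironmentProxy_channelLaw prior inputLaw env κ,
    (proxyDistortion_channelLaw_le prior inputLaw env κ Q).trans h, rfl⟩

end RateDistortion

/-! ### The Gaussian test channel for the ReLU environment -/

section ReLU

variable {N d : ℕ}

/-- The channel that maps the matrix `a` to `α a + W`, where the entries of `W` are independent
centered Gaussians of variance `v`. -/
noncomputable def gaussianChannel (N d : ℕ) (α : ℝ) (v : ℝ≥0) :
    Kernel (Fin N → Fin d → ℝ) (Fin N → Fin d → ℝ) :=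
  (Kernel.id ×ₖ Kernel.const _
    (Measure.pi fun _ : Fin N => Measure.pi fun _ : Fin d => gaussianReal 0 v)).map
      fun p i j => α * p.1 i j + p.2 i j

theorem measurable_gaussianChannel_map (α : ℝ) :
    Measurable fun (p : (Fin N → Fin d → ℝ) × (Fin N → Fin d → ℝ)) i j =>
      α * p.1 i j + p.2 i j := by
  fun_prop

instance (α : ℝ) (v : ℝ≥0) : IsMarkovKernel (gaussianChannel N d α v) :=
  Kernel.IsMarkovKernel.map _ (measurable_gaussianChannel_map α)

instance : IsProbabilityMeasure (standardGaussianInput d) := by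
  unfold standardGaussianInput
  infer_instance

/-- The push-forward definition makes measurability in the matrix automatic; this product form lets
divergences be summed over entries. -/
theorem gaussianChannel_apply (α : ℝ) (v : ℝ≥0) (a : Fin N → Fin d → ℝ) :
    gaussianChannel N d α v a =
      Measure.pi fun i => Measure.pi fun j => gaussianReal (α * a i j) v := by
  have h1 : ∀ i, (Measure.pi fun _ : Fin d => gaussianReal 0 v).map
      (fun w j => α * a i j + w j) = Measure.pi fun j => gaussianReal (α * a i j) v := by
    intro i
    have hs : ∀ j, SigmaFinite ((gaussianReal 0 v).map (α * a i j + ·)) := by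
      intro j
      rw [gaussianReal_map_const_add]
      infer_instance
    rw [Measure.pi_map_pi (f := fun j t => α * a i j + t) (fun j => by fun_prop)]
    simp only [gaussianReal_map_const_add, zero_add]
  have hs : ∀ i, SigmaFinite ((Measure.pi fun _ : Fin d => gaussianReal 0 v).map
      (fun w j => α * a i j + w j)) := by
    intro i
    rw [h1]
    infer_instance
  rw [gaussianChannel, Kernel.map_apply _ (measurable_gaussianChannel_map α), Kernel.prod_apply,
    Kernel.id_apply, Kernel.const_apply, Measure.dirac_prod,
    Measure.map_map (measurable_gaussianChannel_map α) measurable_prodMk_left]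
  have h2 := Measure.pi_map_pi (μ := fun _ : Fin N => Measure.pi fun _ : Fin d => gaussianReal 0 v)
    (f := fun i w j => α * a i j + w j)
    (fun i => (by fun_prop : Measurable fun (w : Fin d → ℝ) j => α * a i j + w j).aemeasurable)
  simp only [h1] at h2
  exact h2

theorem lintegral_gaussianChannel_entry (α : ℝ) (v : ℝ≥0) (a : Fin N → Fin d → ℝ) (i : Fin N)
    (j : Fin d) {f : ℝ → ℝ≥0∞} (hf : Measurable f) :
    ∫⁻ z, f (z i j) ∂gaussianChannel N d α v a = ∫⁻ t, f t ∂gaussianReal (α * a i j) v := by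
  rw [gaussianChannel_apply]
  have h1 := (measurePreserving_eval
    (fun i => Measure.pi fun j => gaussianReal (α * a i j) v) i).lintegral_comp
      (hf.comp (measurable_pi_apply j))
  have h2 := (measurePreserving_eval (fun j => gaussianReal (α * a i j) v) j).lintegral_comp hf
  exact h1.trans h2

/-- Nonnegative coefficients let `ENNReal.ofReal` split over the sum, so the second moment alone
determines the integral. -/
theorem lintegral_ofReal_affine_sq {Ω : Type*} [MeasurableSpace Ω] (μ : Measure Ω)
    [IsProbabilityMeasure μ] {X : Ω → ℝ} (hX : Measurable X) {m p q : ℝ} (hp : 0 ≤ p) (hq : 0 ≤ q)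
    (hm : 0 ≤ m) (h : ∫⁻ ω, ENNReal.ofReal (X ω ^ 2) ∂μ = ENNReal.ofReal m) :
    ∫⁻ ω, ENNReal.ofReal (p + q * X ω ^ 2) ∂μ = ENNReal.ofReal (p + q * m) := by
  have e : ∀ ω, ENNReal.ofReal (p + q * X ω ^ 2) =
      ENNReal.ofReal p + ENNReal.ofReal q * ENNReal.ofReal (X ω ^ 2) := fun ω => by
    rw [ENNReal.ofReal_add hp (by positivity), ENNReal.ofReal_mul hq]
  simp_rw [e]
  rw [lintegral_add_left measurable_const, lintegral_const_mul _ (by fun_prop), h,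
    ENNReal.ofReal_add hp (by positivity), ENNReal.ofReal_mul hq]
  simp

/-- With equal variances only the squared difference of means survives in each coordinate, and ReLU
is 1-Lipschitz. -/
theorem klDiv_reluEnvironment_le {σsq : ℝ≥0} (hσ : σsq ≠ 0) (a z : Fin N → Fin d → ℝ)
    (x : Fin d → ℝ) :
    klDiv (reluEnvironment N d σsq (a, x)) (reluEnvironment N d σsq (z, x)) ≤
      ENNReal.ofReal (1 / (2 * σsq)) *
        ∑ i, ENNReal.ofReal ((∑ j, (a i j - z i j) * x j) ^ 2) := by
  have hσ0 : (σsq : ℝ) ≠ 0 := by exact_mod_cast hσ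
  change klDiv (Measure.pi fun i => gaussianReal (reluLayer a x i) σsq)
    (Measure.pi fun i => gaussianReal (reluLayer z x i) σsq) ≤ _
  rw [klDiv_pi_fin, Finset.mul_sum]
  refine Finset.sum_le_sum fun i _ => ?_
  rw [klDiv_gaussianReal _ _ hσ hσ, ← ENNReal.ofReal_mul (by positivity)]
  refine ENNReal.ofReal_le_ofReal ?_
  have hlip : |reluLayer a x i - reluLayer z x i| ≤ |∑ j, (a i j - z i j) * x j| := by
    have h := abs_max_sub_max_le_abs (∑ j, a i j * x j) (∑ j, z i j * x j) 0
    rw [← Finset.sum_sub_distrib] at h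
    simpa only [reluLayer, sub_mul] using h
  have hsq := sq_le_sq.mpr hlip
  calc (Real.log σsq - Real.log σsq) / 2
        + (σsq + (reluLayer a x i - reluLayer z x i) ^ 2) / (2 * σsq) - 1 / 2
      = 1 / (2 * σsq) * (reluLayer a x i - reluLayer z x i) ^ 2 := by
        field_simp
        ring
    _ ≤ 1 / (2 * σsq) * (∑ j, (a i j - z i j) * x j) ^ 2 :=
        mul_le_mul_of_nonneg_left hsq (by positivity)

theorem lintegral_klDiv_reluEnvironment_le {σsq : ℝ≥0} (hσ : σsq ≠ 0)
    (a z : Fin N → Fin d → ℝ) :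
    ∫⁻ x, klDiv (reluEnvironment N d σsq (a, x)) (reluEnvironment N d σsq (z, x))
        ∂standardGaussianInput d ≤
      ENNReal.ofReal (1 / (2 * σsq)) * ∑ i, ∑ j, ENNReal.ofReal ((z i j - a i j) ^ 2) := by
  refine (lintegral_mono fun x => klDiv_reluEnvironment_le hσ a z x).trans ?_
  rw [lintegral_const_mul _ (by fun_prop), lintegral_finsetSum _ fun i _ => by fun_prop]
  refine mul_le_mul_right (Finset.sum_le_sum fun i _ => ?_) _
  rw [lintegral_linear_sq_standardGaussianInput,
    ENNReal.ofReal_sum_of_nonneg fun j _ => sq_nonneg _]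
  refine Finset.sum_le_sum fun j _ => ?_
  rw [sub_sq_comm]

variable (prior : Measure (Fin N → Fin d → ℝ)) [IsProbabilityMeasure prior]

/-- The error in each entry has variance `v` from the noise and bias `(α - 1) a i j` from the
shrinkage. -/
theorem gaussianChannel_distortion_le {σsq : ℝ≥0} (hσ : σsq ≠ 0)
    (hprior : ∀ i j, ∫⁻ a, ENNReal.ofReal (a i j ^ 2) ∂prior = ENNReal.ofReal (1 / d))
    (α : ℝ) (v : ℝ≥0) :
    ∫⁻ a, ∫⁻ z, ∫⁻ x, klDiv (reluEnvironment N d σsq (a, x)) (reluEnvironment N d σsq (z, x))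
        ∂standardGaussianInput d ∂gaussianChannel N d α v a ∂prior ≤
      ENNReal.ofReal (1 / (2 * σsq) * (N * (d * (v + (1 - α) ^ 2 * (1 / d))))) := by
  have h1 : ∀ a : Fin N → Fin d → ℝ, ∫⁻ z, ∫⁻ x, klDiv (reluEnvironment N d σsq (a, x))
      (reluEnvironment N d σsq (z, x)) ∂standardGaussianInput d ∂gaussianChannel N d α v a ≤
      ENNReal.ofReal (1 / (2 * σsq)) *
        ∑ i, ∑ j, ENNReal.ofReal (v + (1 - α) ^ 2 * a i j ^ 2) := by
    intro a
    refine (lintegral_mono fun z => lintegral_klDiv_reluEnvironment_le hσ a z).trans ?_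
    rw [lintegral_const_mul _ (by fun_prop), lintegral_finsetSum _ fun i _ => by fun_prop]
    refine mul_le_mul_right (Finset.sum_le_sum fun i _ => ?_) _
    rw [lintegral_finsetSum _ fun j _ => by fun_prop]
    refine Finset.sum_le_sum fun j _ => ?_
    rw [lintegral_gaussianChannel_entry α v a i j (f := fun t => ENNReal.ofReal ((t - a i j) ^ 2))
      (by fun_prop), lintegral_sub_sq_gaussianReal]
    refine le_of_eq (congrArg _ ?_)
    ring
  refine (lintegral_mono h1).trans (le_of_eq ?_)
  rw [lintegral_const_mul _ (by fun_prop), lintegral_finsetSum _ fun i _ => by fun_prop]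
  have h2 : ∀ i : Fin N, ∫⁻ a, ∑ j, ENNReal.ofReal (v + (1 - α) ^ 2 * a i j ^ 2) ∂prior =
      ENNReal.ofReal (d * (v + (1 - α) ^ 2 * (1 / d))) := by
    intro i
    rw [lintegral_finsetSum _ fun j _ => by fun_prop]
    have h3 : ∀ j : Fin d, ∫⁻ a, ENNReal.ofReal (v + (1 - α) ^ 2 * a i j ^ 2) ∂prior =
        ENNReal.ofReal (v + (1 - α) ^ 2 * (1 / d)) := fun j =>
      lintegral_ofReal_affine_sq prior (by fun_prop) v.coe_nonneg (sq_nonneg _) (by positivity)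
        (hprior i j)
    simp [h3, ENNReal.ofReal_mul]
  simp_rw [h2]
  rw [ENNReal.ofReal_mul (p := 1 / (2 * (σsq : ℝ))) (by positivity),
    ENNReal.ofReal_mul (p := (N : ℝ)) (by positivity)]
  simp

theorem gaussianChannel_klDiv_eq
    (hprior : ∀ i j, ∫⁻ a, ENNReal.ofReal (a i j ^ 2) ∂prior = ENNReal.ofReal (1 / d))
    (α : ℝ) {v s : ℝ≥0} (hv : v ≠ 0) (hs : s ≠ 0) (hvs : (v : ℝ) + α ^ 2 * (1 / d) = s) :
    ∫⁻ a, klDiv (gaussianChannel N d α v a)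
        (Measure.pi fun _ : Fin N => Measure.pi fun _ : Fin d => gaussianReal 0 s) ∂prior =
      ENNReal.ofReal (N * (d * ((Real.log s - Real.log v) / 2))) := by
  have hv0 : (0 : ℝ) < v := by positivity
  have hs0 : (0 : ℝ) < s := by positivity
  -- This is the divergence of `N(0, v)` from `N(0, s)`; its sign is needed to split
  -- `ENNReal.ofReal`.
  have hp : 0 ≤ (Real.log s - Real.log v) / 2 + v / (2 * s) - 1 / 2 := by
    have h := Real.log_le_sub_one_of_pos (div_pos hv0 hs0)
    rw [Real.log_div hv0.ne' hs0.ne'] at h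
    have e : (v : ℝ) / (2 * s) = v / s / 2 := by
      field_simp
    rw [e]
    linarith
  have h1 : ∀ a : Fin N → Fin d → ℝ, klDiv (gaussianChannel N d α v a)
      (Measure.pi fun _ : Fin N => Measure.pi fun _ : Fin d => gaussianReal 0 s) =
      ∑ i, ∑ j, ENNReal.ofReal (((Real.log s - Real.log v) / 2 + v / (2 * s) - 1 / 2)
        + α ^ 2 / (2 * s) * a i j ^ 2) := by
    intro a
    rw [gaussianChannel_apply, klDiv_pi_fin]
    refine Finset.sum_congr rfl fun i _ => ?_
    rw [klDiv_pi_fin]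
    refine Finset.sum_congr rfl fun j _ => ?_
    rw [klDiv_gaussianReal _ _ hv hs]
    congr 1
    ring
  simp_rw [h1]
  rw [lintegral_finsetSum _ fun i _ => by fun_prop]
  have h2 : ∀ i : Fin N, ∫⁻ a, ∑ j, ENNReal.ofReal
      (((Real.log s - Real.log v) / 2 + v / (2 * s) - 1 / 2) + α ^ 2 / (2 * s) * a i j ^ 2) ∂prior =
      ENNReal.ofReal (d * ((Real.log s - Real.log v) / 2)) := by
    intro i
    rw [lintegral_finsetSum _ fun j _ => by fun_prop]
    have h3 : ∀ j : Fin d, ∫⁻ a, ENNReal.ofReal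
        (((Real.log s - Real.log v) / 2 + v / (2 * s) - 1 / 2) + α ^ 2 / (2 * s) * a i j ^ 2)
          ∂prior = ENNReal.ofReal ((Real.log s - Real.log v) / 2) := by
      intro j
      rw [lintegral_ofReal_affine_sq prior (by fun_prop) hp (by positivity) (by positivity)
        (hprior i j)]
      congr 1
      -- As `s` is the second moment of a proxy entry, the quadratic part averages to `1/2` and
      -- cancels the constant `-1/2`.
      have e : (v : ℝ) / (2 * s) + α ^ 2 / (2 * s) * (1 / d) = 1 / 2 := by
        have : (v : ℝ) / (2 * s) + α ^ 2 / (2 * s) * (1 / d)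
            = ((v : ℝ) + α ^ 2 * (1 / d)) / (2 * s) := by ring
        rw [this, hvs]
        field_simp
      linarith
    rw [Finset.sum_congr rfl fun j _ => h3 j]
    simp [ENNReal.ofReal_mul]
  simp_rw [h2]
  rw [ENNReal.ofReal_mul (p := (N : ℝ)) (by positivity)]
  simp

theorem lintegral_sq_map_of_independentPrior {Ω : Type*} [MeasurableSpace Ω] {P : Measure Ω}
    [IsProbabilityMeasure P] {A : Ω → Fin N → Fin d → ℝ} (hA : IndependentPrior A P)
    (i : Fin N) (j : Fin d) :
    ∫⁻ a, ENNReal.ofReal (a i j ^ 2) ∂P.map A = ENNReal.ofReal (1 / d) := by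
  rw [lintegral_map (by fun_prop) hA.measurable]
  have h := variance_eq_sub (hA.memLp i j)
  rw [hA.variance_eq, hA.mean_eq] at h
  rw [← ofReal_integral_eq_lintegral_ofReal (hA.memLp i j).integrable_sq
    (ae_of_all _ fun _ => sq_nonneg _), h]
  simp

theorem rateDistortion_reluEnvironment_le_zero (hd : 0 < d) {σsq ε : ℝ≥0} (hσ : σsq ≠ 0)
    (hprior : ∀ i j, ∫⁻ a, ENNReal.ofReal (a i j ^ 2) ∂prior = ENNReal.ofReal (1 / d))
    (h : (N : ℝ) ≤ 2 * σsq * ε) :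
    rateDistortion prior (standardGaussianInput d) (reluEnvironment N d σsq) ε ≤ 0 := by
  have hdist := gaussianChannel_distortion_le prior hσ hprior 0 0
  have hd0 : (0 : ℝ) < d := by exact_mod_cast hd
  have hσ0 : (0 : ℝ) < σsq := by positivity
  have hε : ENNReal.ofReal (1 / (2 * σsq) * (N * (d * (((0 : ℝ≥0) : ℝ) + (1 - 0) ^ 2 * (1 / d))))) ≤
      (ε : ℝ≥0∞) := by
    rw [← ENNReal.ofReal_coe_nnreal]
    refine ENNReal.ofReal_le_ofReal ?_
    have e : 1 / (2 * (σsq : ℝ)) * (N * (d * (((0 : ℝ≥0) : ℝ) + (1 - 0) ^ 2 * (1 / d)))) =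
        N / (2 * σsq) := by
      simp
      field_simp
    rw [e, div_le_iff₀ (by positivity)]
    linarith
  -- With `α = 0` and `v = 0` the proxy is the zero matrix, whatever `A` is. Its own law serves as
  -- the reference, so the rate vanishes.
  have hR := rateDistortion_le_of_channel prior (standardGaussianInput d) (reluEnvironment N d σsq)
    (gaussianChannel N d 0 0) (reluEnvironment N d σsq) (gaussianChannel N d 0 0 0)
    (hdist.trans hε)
  refine hR.trans (le_of_eq ?_)
  have h0 : ∀ a, gaussianChannel N d 0 0 a = gaussianChannel N d 0 0 0 := by
    intro a
    simp only [gaussianChannel_apply, zero_mul]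
  simp [h0, klDiv_self]

theorem rateDistortion_reluEnvironment_le_log (hd : 0 < d) {σsq ε : ℝ≥0}
    (hσ : σsq ≠ 0) (hε : ε ≠ 0)
    (hprior : ∀ i j, ∫⁻ a, ENNReal.ofReal (a i j ^ 2) ∂prior = ENNReal.ofReal (1 / d))
    (h : 2 * σsq * ε < (N : ℝ)) :
    rateDistortion prior (standardGaussianInput d) (reluEnvironment N d σsq) ε ≤
      ENNReal.ofReal (d * N / 2 * Real.log (N / (2 * σsq * ε))) := by
  have hd0 : (0 : ℝ) < d := by exact_mod_cast hd
  have hσ0 : (0 : ℝ) < σsq := by positivity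
  have hε0 : (0 : ℝ) < ε := by positivity
  have hN0 : (0 : ℝ) < N := lt_trans (by positivity) h
  -- `δ` is the allowed fraction of the variance: each entry may have mean squared error `δ/d`. The
  -- shrinkage `1 - δ` and noise `δ(1 - δ)/d` form the optimal test channel for a Gaussian source:
  -- `δ(1 - δ)/d + δ²/d = δ/d`, and the proxy entries have second moment `(1 - δ)/d`.
  set δ : ℝ := 2 * σsq * ε / N with hδ
  have hδ0 : 0 < δ := by positivity
  have hδ1 : δ < 1 := (div_lt_one hN0).mpr h
  have hα : 0 < 1 - δ := by linarith
  obtain ⟨v, hv⟩ : ∃ v : ℝ≥0, (v : ℝ) = δ * (1 - δ) / d :=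
    ⟨⟨δ * (1 - δ) / d, by positivity⟩, rfl⟩
  obtain ⟨s, hs⟩ : ∃ s : ℝ≥0, (s : ℝ) = (1 - δ) / d := ⟨⟨(1 - δ) / d, by positivity⟩, rfl⟩
  have hv0 : v ≠ 0 := by
    have : (0 : ℝ) < v := by rw [hv]; positivity
    exact_mod_cast this.ne'
  have hs0 : s ≠ 0 := by
    have : (0 : ℝ) < s := by rw [hs]; positivity
    exact_mod_cast this.ne'
  have hvs : (v : ℝ) + (1 - δ) ^ 2 * (1 / d) = s := by
    rw [hv, hs]
    field_simp
    ring
  have hdist := gaussianChannel_distortion_le prior hσ hprior (1 - δ) v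
  have hle : ENNReal.ofReal (1 / (2 * σsq) * (N * (d * (v + (1 - (1 - δ)) ^ 2 * (1 / d))))) ≤
      (ε : ℝ≥0∞) := by
    rw [← ENNReal.ofReal_coe_nnreal]
    refine ENNReal.ofReal_le_ofReal (le_of_eq ?_)
    have e : (d : ℝ) * (v + (1 - (1 - δ)) ^ 2 * (1 / d)) = δ := by
      rw [hv]
      field_simp
      ring
    rw [e, hδ]
    field_simp
  refine (rateDistortion_le_of_channel prior (standardGaussianInput d) (reluEnvironment N d σsq)
    (gaussianChannel N d (1 - δ) v) (reluEnvironment N d σsq)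
    (Measure.pi fun _ : Fin N => Measure.pi fun _ : Fin d => gaussianReal 0 s)
    (hdist.trans hle)).trans (le_of_eq ?_)
  rw [gaussianChannel_klDiv_eq prior hprior (1 - δ) hv0 hs0 hvs]
  have hlog : Real.log s - Real.log v = Real.log (N / (2 * σsq * ε)) := by
    have hs' : (s : ℝ) ≠ 0 := by exact_mod_cast hs0
    have hv' : (v : ℝ) ≠ 0 := by exact_mod_cast hv0
    rw [← Real.log_div hs' hv', hs, hv]
    congr 1
    rw [← one_div_div (2 * (σsq : ℝ) * ε), ← hδ]
    field_simp
  rw [hlog]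
  congr 1
  ring

end ReLU

/-- The logarithm on the right is the extended one, with `ln (N / 0) = ln ∞ = ∞`. -/
theorem mainTheorem7 (d N : ℕ) (hd : 0 < d) (hN : 0 < N) (σsq ε : ℝ≥0)
    {Ω : Type*} [MeasurableSpace Ω] (P : Measure Ω) [IsProbabilityMeasure P]
    (A : Ω → Fin N → Fin d → ℝ) (hA : IndependentPrior A P) :
    ((rateDistortion (P.map A) (standardGaussianInput d) (reluEnvironment N d σsq) ε : ℝ≥0∞) :
        EReal) ≤
      (((d : ℝ) * (N : ℝ) / 2 : ℝ) : EReal) *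
        max 0 (ENNReal.log ((N : ℝ≥0∞) / (2 * (σsq : ℝ≥0∞) * (ε : ℝ≥0∞)))) := by
  have hd0 : (0 : ℝ) < d := by exact_mod_cast hd
  have hN0 : (0 : ℝ) < N := by exact_mod_cast hN
  have hprob : IsProbabilityMeasure (P.map A) :=
    Measure.isProbabilityMeasure_map hA.measurable.aemeasurable
  have hprior := lintegral_sq_map_of_independentPrior hA
  -- In the degenerate case the right-hand side is infinite, because `dN/2 > 0`.
  by_cases h0 : σsq = 0 ∨ ε = 0
  · have hz : 2 * (σsq : ℝ≥0∞) * (ε : ℝ≥0∞) = 0 := by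
      rcases h0 with h | h <;> simp [h]
    rw [hz, ENNReal.div_zero (by exact_mod_cast hN.ne'), ENNReal.log_top,
      max_eq_right le_top, EReal.coe_mul_top_of_pos (by positivity)]
    exact le_top
  · push Not at h0
    obtain ⟨hσ, hε⟩ := h0
    have hσ0 : (0 : ℝ) < σsq := by positivity
    have hε0 : (0 : ℝ) < ε := by positivity
    rcases le_or_gt (N : ℝ) (2 * σsq * ε) with h | h
    · have hr := rateDistortion_reluEnvironment_le_zero (P.map A) hd hσ hprior h
      rw [nonpos_iff_eq_zero.mp hr, EReal.coe_ennreal_zero]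
      exact EReal.mul_nonneg (by exact_mod_cast (by positivity : (0 : ℝ) ≤ d * N / 2))
        (le_max_left _ _)
    · have hr := rateDistortion_reluEnvironment_le_log (P.map A) hd hσ hε hprior h
      have hratio : (N : ℝ≥0∞) / (2 * (σsq : ℝ≥0∞) * (ε : ℝ≥0∞)) =
          ENNReal.ofReal (N / (2 * σsq * ε)) := by
        rw [ENNReal.ofReal_div_of_pos (by positivity), ENNReal.ofReal_mul (by positivity),
          ENNReal.ofReal_mul (by positivity)]
        simp
      have hlog0 : 0 ≤ Real.log (N / (2 * σsq * ε)) :=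
        Real.log_nonneg ((one_le_div (by positivity)).mpr h.le)
      rw [hratio, ENNReal.log_ofReal_of_pos (by positivity),
        max_eq_right (by exact_mod_cast hlog0), ← EReal.coe_mul]
      refine (EReal.coe_ennreal_le_coe_ennreal_iff.mpr hr).trans (le_of_eq ?_)
      rw [EReal.coe_ennreal_ofReal, max_eq_left (by positivity)]
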